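/- **Setting.** Graphs are finite, simple and connected, and their nodes carry unique identifiers (natural numbers) encoded using $O(\log n)$ bits, where $n$ is the number of nodes; precisely, for a fixed constant $c$, every identifier in an $n$-node graph has at most $c(\lfloor\log_2 n\rfloor+1)$ bits. A *configuration family* $(\mathcal G,\mathcal I)$ is given by a family $\mathcal G$ of such graphs and a set $\mathcal I$ of binary strings; its configurations are the pairs $(G,I)$ with $G\in\mathcal G$ and $I:V(G)\to\mathcal I$. A *predicate* $P$ on $(\mathcal G,\mathcal I)$ is a set of configurations. For a radius $r=r(n)$, an *$r$-hop proof labeling scheme* ($r$-PLS) for $P$ is a pair $(\mathrm{Prov},\mathrm{Ver})$. The prover $\mathrm{Prov}$ assigns to each $(G,I)\in P$ a labeling $\mathrm{Prov}(G,I):V(G)\to\{0,1\}^*$. The verifier $\mathrm{Ver}$ accepts or rejects at a node $v$ as a function of $n=|V(G)|$, of $v$, and of the $r(n)$-hop neighborhood $B_{r(n)}(v)$ of $v$ with its identifiers, induced edges, inputs and labels. It is required that * (completeness) if $(G,I)\in P$, all nodes accept under the labeling $\mathrm{Prov}(G,I)$; * (soundness) if, for a configuration $(G,I)$ and some labeling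 $\ell:V(G)\to\{0,1\}^*$, all nodes accept, then $(G,I)\in P$. The *cost* of the scheme, as a function of $n$, is the maximum of $|\mathrm{Prov}(G,I)(v)|$ over all $(G,I)\in P$ with $|V(G)|=n$ and all $v\in V(G)$. **Theorem.** Let $(\mathcal G,\mathcal I)$ be a configuration family and $P$ a predicate on it. If there is a $1$-PLS for $P$ with cost at most $p=p(n)$, then for every integer $t=t(n)\ge 1$ there is an $O(t\log n)$-PLS for $P$ with cost $O(\lceil p/t\rceil)$. Precisely: for every $c$ there is a constant $K\in\mathbb N$, depending only on $c$, such that for all $(\mathcal G,\mathcal I)$, $P$, $p:\mathbb N\to\mathbb N$ and $t:\mathbb N\to\mathbb N_{\ge1}$ as above there is an $r$-PLS for $P$ with $r(n)=K\,t(n)\lfloor\log_2 n\rfloor$ whose cost is at most $K\lceil p(n)/t(n)\rceil$ for every $n$. -/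

import Mathlib

/-- Finite binary strings, used for inputs and for labels. -/
abbrev BitString := List Bool

/-- A finite graph whose nodes carry unique identifiers: a node is its identifier. -/
structure NetGraph where
  /-- the nodes -/
  verts : Finset ℕ
  /-- the edges -/
  graph : SimpleGraph verts

/-- The number `n` of nodes. -/
def NetGraph.size (G : NetGraph) : ℕ := G.verts.card

/-- All identifiers are encoded by at most `c * (⌊log₂ n⌋ + 1)` bits. -/
def NetGraph.IdBitsLE (G : NetGraph) (c : ℕ) : Prop :=
  ∀ v ∈ G.verts, Nat.size v ≤ c * (Nat.log 2 G.size + 1)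

/-- A graph together with an assignment of input strings to its nodes. -/
structure Config where
  net : NetGraph
  input : net.verts → BitString

/-- The configurations with graph in `𝒢` and all inputs in `ℐ`. -/
def configs (𝒢 : Set NetGraph) (ℐ : Set BitString) : Set Config :=
  {C | C.net ∈ 𝒢 ∧ ∀ v, C.input v ∈ ℐ}

/-- The nodes of a configuration. -/
abbrev Config.Node (C : Config) : Type := C.net.verts

/-- The nodes at distance at most `r` from `v`. The extended distance is used, so that nodes in
other connected components are at distance `⊤`. -/
def Config.ball (C : Config) (r : ℕ) (v : C.Node) : Set C.Node :=
  {u | C.net.graph.edist v u ≤ (r : ℕ∞)}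

/-- What a node knows when it decides: the number of nodes of the graph, its own identifier, and,
within its ball, the nodes (identifiers), the induced edges, the inputs and the labels. -/
structure View where
  size : ℕ
  center : ℕ
  nodes : Set ℕ
  adj : ℕ → ℕ → Prop
  /-- `none` outside the ball -/
  input : ℕ → Option BitString
  /-- `none` outside the ball -/
  label : ℕ → Option BitString

open Classical in
/-- The information in the `r`-hop neighbourhood of `v` under the labelling `l`. -/
noncomputable def Config.view (C : Config) (l : C.Node → BitString) (r : ℕ) (v : C.Node) : View where
  size := C.net.size
  center := v
  nodes := Subtype.val '' C.ball r v
  adj := fun a b => ∃ x ∈ C.ball r v, ∃ y ∈ C.ball r v,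
    (x : ℕ) = a ∧ (y : ℕ) = b ∧ C.net.graph.Adj x y
  input := fun a =>
    if h : ∃ x ∈ C.ball r v, (x : ℕ) = a then some (C.input h.choose) else none
  label := fun a =>
    if h : ∃ x ∈ C.ball r v, (x : ℕ) = a then some (l h.choose) else none

/-- A proof labeling scheme for the predicate `P` on the configurations over `(𝒢, ℐ)`, in which
a node of an `n`-node graph sees its `r n`-hop neighbourhood. The values of `prov` outside `P`
play no role. -/
structure PLS {𝒢 : Set NetGraph} {ℐ : Set BitString} (P : configs 𝒢 ℐ → Prop) (r : ℕ → ℕ) where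
  /-- the honest prover -/
  prov : (C : configs 𝒢 ℐ) → C.1.Node → BitString
  /-- the verifier: it accepts a view if the proposition holds -/
  ver : View → Prop
  completeness : ∀ C : configs 𝒢 ℐ, P C →
    ∀ v : C.1.Node, ver (C.1.view (prov C) (r C.1.net.size) v)
  soundness : ∀ (C : configs 𝒢 ℐ) (l : C.1.Node → BitString),
    (∀ v : C.1.Node, ver (C.1.view l (r C.1.net.size) v)) → P C

/-- The cost on `n`-node graphs: the largest length of a label which the honest prover assigns in
a configuration that satisfies `P` (`⊤` if these lengths are unbounded). -/
noncomputable def PLS.cost {𝒢 : Set NetGraph} {ℐ : Set BitString} {P : configs 𝒢 ℐ → Prop}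
    {r : ℕ → ℕ} (S : PLS P r) (n : ℕ) : ℕ∞ :=
  ⨆ (C : configs 𝒢 ℐ) (_ : P C ∧ C.1.net.size = n) (v : C.1.Node), ((S.prov C v).length : ℕ∞)

/-! Only nodes next to a foreign cluster need a stored certificate. The graph is carved greedily
into clusters by ball growing, each time around the smallest remaining identifier: some ball of
radius O(t log n) in the remaining graph grows over its next two layers by a factor of at most 1 +
1/t. The ball becomes the core, and the first of the two layers is marked and completes the cluster.
The nodes whose certificates a core must store lie in these two layers, hence are t times rarer than
the core nodes (`exists_isDecomposition`), so each certificate is cut into t chunks held by distinct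
core nodes. One extra bit per label records the marks. Cores are the components of unmarked nodes,
so clusters and storage places can be recomputed locally (`exists_encoding`,
`Network.Agree.decode_eq`).

The verifier accepts exactly the views that occur in honestly labelled configurations satisfying
`P`. If all nodes accept, each cluster adopts the configuration that witnesses acceptance at its
smallest identifier, and its nodes take their certificates from there. Within a cluster these come
from a single configuration; across a cluster border they are decoded from labels that both
witnesses share. Hence every 1-hop view is accepted by the original scheme, whose soundness gives
`P` (`PLS.of_forall_view_eq_encodes`). -/

/-! ### Distance bounds by natural numbers -/

theorem SimpleGraph.edist_le_succ_iff {V : Type*} (G : SimpleGraph V) (k : ℕ) (u v : V) :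
    G.edist u v ≤ ((k + 1 : ℕ) : ℕ∞) ↔
      ∃ w, G.edist u w ≤ (k : ℕ∞) ∧ (w = v ∨ G.Adj w v) := by
  constructor
  · intro h
    have hne : G.edist u v ≠ ⊤ := ne_top_of_le_ne_top (ENat.natCast_ne_top _) h
    obtain ⟨p, hp⟩ := G.exists_walk_of_edist_ne_top hne
    rw [← hp] at h
    have h' : p.length ≤ k + 1 := by exact_mod_cast h
    by_cases hk : p.length ≤ k
    · exact ⟨v, (G.edist_le p).trans (by exact_mod_cast hk), Or.inl rfl⟩
    · have hnil : ¬ p.Nil := by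
        intro hn
        rw [← SimpleGraph.Walk.length_eq_zero_iff] at hn
        omega
      refine ⟨p.penultimate, (G.edist_le p.dropLast).trans ?_, Or.inr (p.adj_penultimate hnil)⟩
      have := p.length_dropLast_add_one hnil
      exact_mod_cast (by omega : p.dropLast.length ≤ k)
  · rintro ⟨w, hw, rfl | hadj⟩
    · exact hw.trans (by exact_mod_cast Nat.le_succ k)
    · push_cast
      exact G.edist_triangle.trans
        (add_le_add hw (SimpleGraph.edist_eq_one_iff_adj.mpr hadj).le)

theorem SimpleGraph.edist_le_add {V : Type*} {G : SimpleGraph V} {a b : ℕ} {u v w : V}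
    (h : G.edist u v ≤ (a : ℕ∞)) (h' : G.edist v w ≤ (b : ℕ∞)) :
    G.edist u w ≤ ((a + b : ℕ) : ℕ∞) := by
  push_cast
  exact G.edist_triangle.trans (add_le_add h h')

theorem SimpleGraph.Adj.edist_le_one {V : Type*} {G : SimpleGraph V} {u v : V} (h : G.Adj u v) :
    G.edist u v ≤ ((1 : ℕ) : ℕ∞) := by
  simpa using (SimpleGraph.edist_eq_one_iff_adj.mpr h).le

theorem SimpleGraph.edist_le_mono {V : Type*} {G : SimpleGraph V} {a b : ℕ} {u v : V}
    (h : G.edist u v ≤ (a : ℕ∞)) (hab : a ≤ b) : G.edist u v ≤ (b : ℕ∞) :=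
  h.trans (by exact_mod_cast hab)

/-! ### Clusterings given by a set of marked nodes -/

section Clustering

variable (G : SimpleGraph ℕ) (M : Set ℕ)

/-- The subgraph of `G` on the edges between unmarked nodes. -/
def unmarkedGraph : SimpleGraph ℕ where
  Adj x y := G.Adj x y ∧ x ∉ M ∧ y ∉ M
  symm := ⟨fun _ _ h => ⟨h.1.symm, h.2.2, h.2.1⟩⟩
  loopless := ⟨fun _ h => h.1.ne rfl⟩

/-- The core of `u`: its component after deleting the marked nodes. -/
def core (u : ℕ) : Set ℕ := {x | (unmarkedGraph G M).Reachable u x}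

/-- The smallest identifier in the core of `u`, or, if `u` is marked, in the adjacent cores. -/
noncomputable def cluster (u : ℕ) : ℕ :=
  sInf {x | ∃ w, w ∉ M ∧ (w = u ∨ (u ∈ M ∧ G.Adj u w)) ∧ x ∈ core G M w}

/-- The node has a neighbour in another cluster. -/
def Crossing (u : ℕ) : Prop := ∃ w, G.Adj u w ∧ cluster G M w ≠ cluster G M u

/-- The smallest cluster that meets the closed neighbourhood of `u`. -/
noncomputable def home (u : ℕ) : ℕ :=
  sInf {z | ∃ w, (w = u ∨ G.Adj u w) ∧ z = cluster G M w}

/-- The nodes whose certificate is stored in the core of `z`. -/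
def storedNodes (z : ℕ) : Set ℕ := {u | Crossing G M u ∧ home G M u = z}

/-- Cores have diameter at most `D`, and every marked node is adjacent to a core. -/
structure IsClustering (D : ℕ) : Prop where
  bounded : ∀ u, ∀ x ∈ core G M u, G.edist u x ≤ (D : ℕ∞)
  covered : ∀ u ∈ M, ∃ w, w ∉ M ∧ G.Adj u w

/-- Every core has room for `t` chunks of each certificate that it has to store. -/
def HasCapacity (t : ℕ) : Prop :=
  ∀ u, Crossing G M u → (storedNodes G M (home G M u)).Finite ∧
    (core G M (home G M u)).Finite ∧
    (storedNodes G M (home G M u)).ncard * t ≤ (core G M (home G M u)).ncard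

variable {G M}

theorem IsClustering.mono {D D' : ℕ} (h : IsClustering G M D) (hD : D ≤ D') :
    IsClustering G M D' :=
  ⟨fun u x hx => SimpleGraph.edist_le_mono (h.bounded u x hx) hD, h.covered⟩

theorem mem_core_self (u : ℕ) : u ∈ core G M u := SimpleGraph.Reachable.refl u

theorem IsClustering.cluster_spec {D : ℕ} (h : IsClustering G M D) (u : ℕ) :
    ∃ w, w ∉ M ∧ (w = u ∨ (u ∈ M ∧ G.Adj u w)) ∧ cluster G M u ∈ core G M w := by
  apply Nat.sInf_mem (s := {x | ∃ w, w ∉ M ∧ (w = u ∨ (u ∈ M ∧ G.Adj u w)) ∧ x ∈ core G M w})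
  by_cases hu : u ∈ M
  · obtain ⟨w, hw, hadj⟩ := h.covered u hu
    exact ⟨w, w, hw, Or.inr ⟨hu, hadj⟩, mem_core_self w⟩
  · exact ⟨u, u, hu, Or.inl rfl, mem_core_self u⟩

theorem IsClustering.edist_cluster {D : ℕ} (h : IsClustering G M D) (u : ℕ) :
    G.edist u (cluster G M u) ≤ ((D + 1 : ℕ) : ℕ∞) := by
  obtain ⟨w, -, hw, hc⟩ := h.cluster_spec u
  have h1 := h.bounded w _ hc
  rcases hw with rfl | ⟨-, hadj⟩
  · exact SimpleGraph.edist_le_mono h1 (Nat.le_succ D)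
  · exact SimpleGraph.edist_le_mono (SimpleGraph.edist_le_add hadj.edist_le_one h1) (by omega)

theorem home_spec (u : ℕ) :
    ∃ w, (w = u ∨ G.Adj u w) ∧ home G M u = cluster G M w :=
  Nat.sInf_mem (s := {z | ∃ w, (w = u ∨ G.Adj u w) ∧ z = cluster G M w}) ⟨_, u, Or.inl rfl, rfl⟩

theorem home_le {u w : ℕ} (h : w = u ∨ G.Adj u w) : home G M u ≤ cluster G M w :=
  Nat.sInf_le ⟨w, h, rfl⟩

theorem IsClustering.edist_home {D : ℕ} (h : IsClustering G M D) (u : ℕ) :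
    G.edist u (home G M u) ≤ ((D + 2 : ℕ) : ℕ∞) := by
  obtain ⟨w, hw, hc⟩ := home_spec (G := G) (M := M) u
  have h1 := h.edist_cluster w
  rw [hc]
  rcases hw with rfl | hadj
  · exact SimpleGraph.edist_le_mono h1 (by omega)
  · exact SimpleGraph.edist_le_mono (SimpleGraph.edist_le_add hadj.edist_le_one h1) (by omega)

end Clustering

/-! ### Storage -/

/-- A choice of `t` places in `B` for each element of `A`, injective if there is enough room. -/
noncomputable def alloc (t : ℕ) (A B : Set ℕ) : ℕ × ℕ → ℕ :=
  Classical.epsilon fun f => Set.InjOn f (A ×ˢ Set.Iio t) ∧ Set.MapsTo f (A ×ˢ Set.Iio t) B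

theorem alloc_spec {t : ℕ} {A B : Set ℕ} (hA : A.Finite) (hB : B.Finite)
    (h : A.ncard * t ≤ B.ncard) :
    Set.InjOn (alloc t A B) (A ×ˢ Set.Iio t) ∧
      Set.MapsTo (alloc t A B) (A ×ˢ Set.Iio t) B := by
  apply Classical.epsilon_spec (p := fun f : ℕ × ℕ → ℕ =>
    Set.InjOn f (A ×ˢ Set.Iio t) ∧ Set.MapsTo f (A ×ˢ Set.Iio t) B)
  have hfin : (A ×ˢ Set.Iio t).Finite := hA.prod (Set.finite_Iio t)
  have hcard : (A ×ˢ Set.Iio t).ncard ≤ B.ncard := by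
    rw [Set.ncard_prod]
    simpa [Set.ncard_eq_toFinset_card'] using h
  obtain ⟨f, hf, hinj⟩ := hfin.exists_injOn_of_encard_le (t := B) (by
    rw [← hfin.cast_ncard_eq, ← hB.cast_ncard_eq]
    exact_mod_cast hcard)
  exact ⟨f, hinj, fun x hx => hf hx⟩

/-! ### Networks -/

/-- A graph on the natural numbers with inputs and labels. -/
structure Network where
  graph : SimpleGraph ℕ
  input : ℕ → BitString
  label : ℕ → BitString

namespace Network

/-- The nodes whose label starts with a one. -/
def marks (N : Network) : Set ℕ := {u | (N.label u).head? = some true}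

/-- The label without its first bit. -/
def payload (N : Network) (u : ℕ) : BitString := (N.label u).tail

/-- The certificate of `u` that is stored in the core of its home cluster. -/
noncomputable def decode (N : Network) (t : ℕ) (u : ℕ) : BitString :=
  (List.range t).flatMap fun i =>
    N.payload (alloc t (storedNodes N.graph N.marks (home N.graph N.marks u))
      (core N.graph N.marks (home N.graph N.marks u)) (u, i))

/-- The two networks are the same on the ball of radius `R` around `v`, including the edges that
leave the ball. -/
def Agree (N N' : Network) (v R : ℕ) : Prop :=
  ∀ x, N.graph.edist v x ≤ (R : ℕ∞) → (∀ y, N.graph.Adj x y ↔ N'.graph.Adj x y) ∧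
    N.input x = N'.input x ∧ N.label x = N'.label x

/-! ### Locality of clusters, homes and decoded certificates -/

variable {N N' : Network} {u v R D : ℕ}

/-- Edges leaving the ball are shared too, so a path may take one step beyond radius `R`. -/
theorem Agree.edist_le (h : Agree N N' v R) {k : ℕ} (hk : k ≤ R + 1) {x : ℕ}
    (hx : N.graph.edist v x ≤ (k : ℕ∞)) : N'.graph.edist v x ≤ (k : ℕ∞) := by
  induction k generalizing x with
  | zero => simpa using hx
  | succ k ih =>
    rw [SimpleGraph.edist_le_succ_iff] at hx ⊢
    obtain ⟨w, hw, hwx⟩ := hx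
    refine ⟨w, ih (by omega) hw, hwx.imp_right fun hadj => ?_⟩
    exact ((h w (SimpleGraph.edist_le_mono hw (by omega))).1 x).mp hadj

theorem Agree.edist_le' (h : Agree N N' v R) {k : ℕ} (hk : k ≤ R + 1) {x : ℕ}
    (hx : N'.graph.edist v x ≤ (k : ℕ∞)) : N.graph.edist v x ≤ (k : ℕ∞) := by
  induction k generalizing x with
  | zero => simpa using hx
  | succ k ih =>
    rw [SimpleGraph.edist_le_succ_iff] at hx ⊢
    obtain ⟨w, hw, hwx⟩ := hx
    have := ih (by omega) hw
    refine ⟨w, this, hwx.imp_right fun hadj => ?_⟩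
    exact ((h w (SimpleGraph.edist_le_mono this (by omega))).1 x).mpr hadj

theorem Agree.symm (h : Agree N N' v R) : Agree N' N v R := fun x hx => by
  obtain ⟨h1, h2, h3⟩ := h x (h.edist_le' (Nat.le_succ R) hx)
  exact ⟨fun y => (h1 y).symm, h2.symm, h3.symm⟩

theorem Agree.recenter (h : Agree N N' v R) {k R' : ℕ} (hu : N.graph.edist v u ≤ (k : ℕ∞))
    (hR : k + R' ≤ R) : Agree N N' u R' := fun x hx =>
  h x (SimpleGraph.edist_le_mono (SimpleGraph.edist_le_add hu hx) hR)

theorem Agree.mono (h : Agree N N' v R) {R' : ℕ} (hR : R' ≤ R) : Agree N N' v R' := fun x hx =>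
  h x (SimpleGraph.edist_le_mono hx hR)

theorem Agree.adj_iff (h : Agree N N' v R) (y : ℕ) : N.graph.Adj v y ↔ N'.graph.Adj v y :=
  (h v (by simp)).1 y

theorem Agree.mem_marks_iff (h : Agree N N' v R) : v ∈ N.marks ↔ v ∈ N'.marks := by
  simp only [marks, Set.mem_ofPred_eq, (h v (by simp)).2.2]

theorem Agree.step (h : Agree N N' v (R + 1)) (huv : u = v ∨ N.graph.Adj v u) :
    Agree N N' u R := by
  rcases huv with rfl | hadj
  · exact h.mono (Nat.le_succ R)
  · exact h.recenter hadj.edist_le_one (by omega)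

/-- Only the second network is required to have small cores. -/
theorem Agree.core_eq (h : Agree N N' u (D + 1)) (hb : ∀ x ∈ core N'.graph N'.marks u,
    N'.graph.edist u x ≤ (D : ℕ∞)) : core N.graph N.marks u = core N'.graph N'.marks u := by
  have hadj : ∀ x ∈ core N'.graph N'.marks u, ∀ y, (unmarkedGraph N.graph N.marks).Adj x y ↔
      (unmarkedGraph N'.graph N'.marks).Adj x y := by
    intro x hx y
    have hx' : Agree N N' x 1 := h.recenter (h.edist_le' (by omega) (hb x hx)) le_rfl
    constructor
    · rintro ⟨h1, h2, h3⟩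
      exact ⟨(hx'.adj_iff y).mp h1, fun h => h2 (hx'.mem_marks_iff.mpr h),
        fun h => h3 ((hx'.step (Or.inr h1)).mem_marks_iff.mpr h)⟩
    · rintro ⟨h1, h2, h3⟩
      have h1' := (hx'.adj_iff y).mpr h1
      exact ⟨h1', fun h => h2 (hx'.mem_marks_iff.mp h),
        fun h => h3 ((hx'.step (Or.inr h1')).mem_marks_iff.mp h)⟩
  ext x
  constructor
  · intro hx
    rw [core, Set.mem_ofPred_eq, SimpleGraph.reachable_iff_reflTransGen] at hx
    -- The path never leaves the core computed in `N'`, where both networks have the same unmarked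
    -- edges; so no bound on the core in `N` is needed.
    induction hx with
    | refl => exact mem_core_self u
    | tail _ hyz ih => exact SimpleGraph.Reachable.trans ih ((hadj _ ih _).mp hyz).reachable
  · intro hx
    rw [core, Set.mem_ofPred_eq, SimpleGraph.reachable_iff_reflTransGen] at hx
    induction hx with
    | refl => exact mem_core_self u
    | tail hy hyz ih =>
      refine SimpleGraph.Reachable.trans ih ((hadj _ ?_ _).mpr hyz).reachable
      rwa [core, Set.mem_ofPred_eq, SimpleGraph.reachable_iff_reflTransGen]

theorem Agree.cluster_eq (h : Agree N N' u (D + 2)) (hc : IsClustering N'.graph N'.marks D) :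
    cluster N.graph N.marks u = cluster N'.graph N'.marks u := by
  unfold cluster
  congr 1
  ext x
  refine exists_congr fun w => ?_
  have hst : (w = u ∨ (u ∈ N.marks ∧ N.graph.Adj u w)) ↔
      (w = u ∨ (u ∈ N'.marks ∧ N'.graph.Adj u w)) := by
    rw [h.adj_iff, h.mem_marks_iff]
  by_cases hw : w = u ∨ (u ∈ N.marks ∧ N.graph.Adj u w)
  · have hw' : Agree N N' w (D + 1) := h.step (hw.imp_right And.right)
    rw [← hst, hw'.core_eq (hc.bounded w), hw'.mem_marks_iff]
  · rw [← hst]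
    tauto

theorem Agree.crossing_iff (h : Agree N N' u (D + 3)) (hc : IsClustering N'.graph N'.marks D) :
    Crossing N.graph N.marks u ↔ Crossing N'.graph N'.marks u := by
  refine exists_congr fun w => ?_
  rw [← h.adj_iff]
  refine and_congr_right fun hw => ?_
  rw [(h.step (Or.inr hw)).cluster_eq hc, (h.mono (Nat.le_succ _)).cluster_eq hc]

theorem Agree.home_eq (h : Agree N N' u (D + 3)) (hc : IsClustering N'.graph N'.marks D) :
    home N.graph N.marks u = home N'.graph N'.marks u := by
  unfold home
  congr 1
  ext z
  refine exists_congr fun w => ?_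
  rw [← h.adj_iff]
  refine and_congr_right fun hw => ?_
  rw [(h.step hw).cluster_eq hc]

/-- The radius: `D + 2` from `u` to its home, `D + 2` from there to a stored node, and `D + 3` to
determine that node's crossing status and home. -/
theorem Agree.storedNodes_subset (h : Agree N N' u (3 * D + 7))
    (hc : IsClustering N.graph N.marks D) (hc' : IsClustering N'.graph N'.marks D) :
    storedNodes N.graph N.marks (home N.graph N.marks u) ⊆
      storedNodes N'.graph N'.marks (home N'.graph N'.marks u) := by
  rintro y ⟨hy, hyz⟩
  have h1 := hc.edist_home y
  rw [hyz, SimpleGraph.edist_comm] at h1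
  have h2 : Agree N N' y (D + 3) :=
    h.recenter (SimpleGraph.edist_le_add (hc.edist_home u) h1) (by omega)
  refine ⟨(h2.crossing_iff hc').mp hy, ?_⟩
  rw [← h2.home_eq hc', hyz]
  exact (h.mono (by omega)).home_eq hc'

theorem Agree.decode_eq {t : ℕ} (h : Agree N N' u (3 * D + 7))
    (hc : IsClustering N.graph N.marks D) (hc' : IsClustering N'.graph N'.marks D)
    (hcap : HasCapacity N'.graph N'.marks t) (hu : Crossing N'.graph N'.marks u) :
    N.decode t u = N'.decode t u := by
  have hhome : home N.graph N.marks u = home N'.graph N'.marks u :=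
    Agree.home_eq (h.mono (by omega)) hc'
  have hst : storedNodes N.graph N.marks (home N.graph N.marks u) =
      storedNodes N'.graph N'.marks (home N'.graph N'.marks u) :=
    (h.storedNodes_subset hc hc').antisymm (h.symm.storedNodes_subset hc' hc)
  have hz : Agree N N' (home N.graph N.marks u) (2 * D + 5) :=
    h.recenter (hc.edist_home u) (by omega)
  have hcore : core N.graph N.marks (home N.graph N.marks u) =
      core N'.graph N'.marks (home N'.graph N'.marks u) := by
    rw [Agree.core_eq (hz.mono (by omega)) (hc'.bounded _), hhome]
  unfold decode
  -- `alloc` depends only on the two sets and `t`, so equal sets give the same storage places in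
  -- both networks.
  rw [hst, hcore]
  obtain ⟨hf, hf', hle⟩ := hcap u hu
  refine List.flatMap_congr fun i hi => ?_
  have hmem := (alloc_spec hf hf' hle).2 (x := (u, i)) ⟨⟨hu, rfl⟩, by simpa using hi⟩
  rw [← hcore] at hmem
  have h3 := hc.bounded _ _ hmem
  rw [← hcore, payload, payload, (hz _ (SimpleGraph.edist_le_mono h3 (by omega))).2.2]

end Network

/-! ### Ball growing -/

/-- Bernoulli's inequality for (1 + 1/t)^t, with denominators cleared. -/
theorem two_mul_pow_le_succ_pow (t : ℕ) (ht : 1 ≤ t) : 2 * t ^ t ≤ (t + 1) ^ t := by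
  have h := one_add_mul_le_pow (a := (1 / t : ℚ))
    (le_trans (by norm_num) (by positivity : (0 : ℚ) ≤ 1 / t)) t
  have ht' : (t : ℚ) ≠ 0 := by positivity
  rw [mul_one_div_cancel ht', one_add_one_eq_two] at h
  have h2 : (2 : ℚ) * t ^ t ≤ (1 + 1 / t) ^ t * t ^ t :=
    mul_le_mul_of_nonneg_right h (by positivity)
  rw [← mul_pow, add_mul, one_mul, one_div_mul_cancel ht'] at h2
  exact_mod_cast h2

/-- Otherwise `b` would grow by a factor above 1 + 1/t in each of `t * m` steps, hence at least to
2^m. -/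
theorem exists_slow_growth {b : ℕ → ℕ} {t m n : ℕ} (ht : 1 ≤ t) (h0 : 1 ≤ b 0)
    (hb : ∀ j, b j ≤ n) (hn : n < 2 ^ m) : ∃ j < t * m, t * b (j + 1) ≤ (t + 1) * b j := by
  by_contra! hcon
  have key : ∀ j ≤ t * m, (t + 1) ^ j ≤ t ^ j * b j := by
    intro j
    induction j with
    | zero => simpa using h0
    | succ j ih =>
      intro hj
      calc (t + 1) ^ (j + 1) = (t + 1) * (t + 1) ^ j := by ring
        _ ≤ (t + 1) * (t ^ j * b j) := Nat.mul_le_mul_left _ (ih (by omega))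
        _ = t ^ j * ((t + 1) * b j) := by ring
        _ ≤ t ^ j * (t * b (j + 1)) := Nat.mul_le_mul_left _ (hcon j (by omega)).le
        _ = t ^ (j + 1) * b (j + 1) := by ring
  have h1 := key (t * m) le_rfl
  have h2 : 2 ^ m * t ^ (t * m) ≤ (t + 1) ^ (t * m) := by
    rw [pow_mul, pow_mul, ← mul_pow]
    exact Nat.pow_le_pow_left (two_mul_pow_le_succ_pow t ht) m
  have h3 : t ^ (t * m) * 2 ^ m ≤ t ^ (t * m) * b (t * m) := by
    rw [mul_comm]
    exact h2.trans h1
  have h4 := Nat.le_of_mul_le_mul_left h3 (by positivity)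
  exact absurd (hb (t * m)) (by omega)

/-! ### Decomposition into clusters with small boundary -/

/-- A partition of `U` into clusters, the level sets of `k`, each of which consists of a core of
radius at most `r` around its center `z` and of marked nodes, such that the boundary of a cluster towards the later clusters
is smaller than its core by a factor of `t`. -/
structure IsDecomposition (G : SimpleGraph ℕ) (t r : ℕ) (U M : Finset ℕ) (k : ℕ → ℕ) : Prop where
  subset : M ⊆ U
  center_mem : ∀ u ∈ U, k u ∈ U
  center_notMem : ∀ u ∈ U, k u ∉ M
  center_eq : ∀ u ∈ U, k (k u) = k u
  center_le : ∀ u ∈ U, k u ≤ u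
  edist_le : ∀ u ∈ U, u ∉ M →
    (unmarkedGraph G ((U \ M : Finset ℕ) : Set ℕ)ᶜ).edist (k u) u ≤ (r : ℕ∞)
  eq_of_adj : ∀ u ∈ U, ∀ w ∈ U, u ∉ M → w ∉ M → G.Adj u w → k u = k w
  exists_adj : ∀ u ∈ M, ∃ w ∈ U, w ∉ M ∧ G.Adj u w ∧ k w = k u
  le_of_adj : ∀ u ∈ M, ∀ w ∈ U, w ∉ M → G.Adj u w → k u ≤ k w
  card_le : ∀ z, {u ∈ (U : Set ℕ) | (u ∈ M ∧ k u = z) ∨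
      (z < k u ∧ ∃ w ∈ U, G.Adj u w ∧ k w = z)}.ncard * t ≤
      {u ∈ (U : Set ℕ) | u ∉ M ∧ k u = z}.ncard

theorem unmarkedGraph_anti (G : SimpleGraph ℕ) {M M' : Set ℕ} (h : M ⊆ M') :
    unmarkedGraph G M' ≤ unmarkedGraph G M := fun _ _ hxy =>
  ⟨hxy.1, fun hx => hxy.2.1 (h hx), fun hy => hxy.2.2 (h hy)⟩

open Classical in
-- One cluster is carved off around the smallest identifier and the rest is decomposed by induction.
-- Thus the order of carving is the order of the centers, which lets a node recognise the earlier of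
-- two clusters.
theorem exists_isDecomposition (G : SimpleGraph ℕ) {t m : ℕ} (ht : 1 ≤ t) (U : Finset ℕ)
    (hU : U.card < 2 ^ m) : ∃ M k, IsDecomposition G t (2 * (t * m)) U M k := by
  induction U using Finset.strongInduction with
  | H U ih =>
  rcases U.eq_empty_or_nonempty with rfl | hne
  · refine ⟨∅, id, ?_⟩
    constructor <;> simp
  set z₀ := U.min' hne with hz₀
  have hz₀U : z₀ ∈ U := U.min'_mem hne
  set GU := unmarkedGraph G ((U : Set ℕ)ᶜ) with hGU
  set B : ℕ → Finset ℕ := fun j => U.filter fun x => GU.edist z₀ x ≤ (j : ℕ∞) with hB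
  have hBU : ∀ j, B j ⊆ U := fun j => Finset.filter_subset _ _
  have hBmono : ∀ {i j}, i ≤ j → B i ⊆ B j := fun {i j} hij x hx => by
    simp only [hB, Finset.mem_filter] at hx ⊢
    exact ⟨hx.1, SimpleGraph.edist_le_mono hx.2 hij⟩
  have hz₀B : ∀ j, z₀ ∈ B j := fun j => by simp [hB, hz₀U]
  have hBadj : ∀ j, ∀ x ∈ B j, ∀ y ∈ U, G.Adj x y → y ∈ B (j + 1) := by
    intro j x hx y hy hxy
    simp only [hB, Finset.mem_filter] at hx ⊢
    refine ⟨hy, (SimpleGraph.edist_le_succ_iff _ _ _ _).mpr ⟨x, hx.2, Or.inr ⟨hxy, ?_, ?_⟩⟩⟩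
    · simpa using hx.1
    · simpa using hy
  have hBpred : ∀ j, ∀ y ∈ B (j + 1), y ∉ B j → ∃ x ∈ B j, G.Adj x y := by
    intro j y hy hy'
    simp only [hB, Finset.mem_filter] at hy hy'
    obtain ⟨x, hx, rfl | hxy⟩ := (SimpleGraph.edist_le_succ_iff _ _ _ _).mp hy.2
    · exact absurd ⟨hy.1, hx⟩ hy'
    · exact ⟨x, by simpa [hB] using ⟨by simpa using hxy.2.1, hx⟩, hxy.1⟩
  -- Growth is compared over two layers at once: the inner one becomes the marked boundary, the
  -- outer one contains the later nodes adjacent to the cluster. Hence the factor 2 in the radius.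
  obtain ⟨j, hj, hgrow⟩ : ∃ j < t * m, t * (B (2 * (j + 1))).card ≤ (t + 1) * (B (2 * j)).card :=
    exists_slow_growth (b := fun j => (B (2 * j)).card) ht
      (Finset.card_pos.mpr ⟨z₀, hz₀B _⟩) (fun j => Finset.card_le_card (hBU _)) hU
  set s := 2 * j with hs
  have hs2 : 2 * (j + 1) = s + 1 + 1 := by omega
  rw [hs2] at hgrow
  have hsub01 : B s ⊆ B (s + 1) := hBmono (Nat.le_succ _)
  have hsub12 : B (s + 1) ⊆ B (s + 1 + 1) := hBmono (Nat.le_succ _)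
  set U' := U \ B (s + 1) with hU'
  have hU'U : U' ⊂ U := by
    refine Finset.ssubset_iff_subset_ne.mpr ⟨Finset.sdiff_subset, fun h => ?_⟩
    have : z₀ ∈ U' := h ▸ hz₀U
    simp [hU', hz₀B] at this
  obtain ⟨M', k', hd⟩ := ih U' hU'U ((Finset.card_le_card hU'U.subset).trans_lt hU)
  set M₀ := B (s + 1) \ B s with hM₀
  set k : ℕ → ℕ := fun u => if u ∈ B (s + 1) then z₀ else k' u with hk
  have hkB : ∀ u ∈ B (s + 1), k u = z₀ := fun u hu => by simp [hk, hu]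
  have hkU' : ∀ u ∈ U', k u = k' u := fun u hu => by
    simp [hk, (Finset.mem_sdiff.mp hu).2]
  have hcases : ∀ u ∈ U, u ∈ B (s + 1) ∨ u ∈ U' := fun u hu => by
    by_cases h : u ∈ B (s + 1)
    · exact Or.inl h
    · exact Or.inr (Finset.mem_sdiff.mpr ⟨hu, h⟩)
  have hU'nB : ∀ u ∈ U', u ∉ B (s + 1) := fun u hu => (Finset.mem_sdiff.mp hu).2
  have hU'mem : ∀ u ∈ U', u ∈ U := fun u hu => hU'U.subset hu
  have hMB : ∀ u ∈ B (s + 1), (u ∈ M₀ ∪ M' ↔ u ∉ B s) := fun u hu => by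
    have : u ∉ M' := fun h => hU'nB u (hd.subset h) hu
    simp [hM₀, hu, this]
  have hMU' : ∀ u ∈ U', (u ∈ M₀ ∪ M' ↔ u ∈ M') := fun u hu => by
    simp [hM₀, hU'nB u hu]
  have hlt : ∀ u ∈ U', z₀ < u := fun u hu =>
    lt_of_le_of_ne (U.min'_le u (hU'mem u hu)) fun h => hU'nB u hu (h ▸ hz₀B _)
  have hklt : ∀ u ∈ U', z₀ < k u := fun u hu => by
    rw [hkU' u hu]
    exact hlt _ (hd.center_mem u hu)
  have hkz : ∀ u ∈ U, k u = z₀ → u ∈ B (s + 1) := fun u hu h =>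
    (hcases u hu).resolve_right fun hu' => (hklt u hu').ne' h
  have hBs : ∀ u ∈ B s, ∀ w ∈ U', ¬ G.Adj u w := fun u hu w hw hadj =>
    hU'nB w hw (hBadj s u hu w (hU'mem w hw) hadj)
  refine ⟨M₀ ∪ M', k, ?_⟩
  constructor
  case subset =>
    exact Finset.union_subset (Finset.sdiff_subset.trans (hBU _))
      (hd.subset.trans hU'U.subset)
  case center_mem =>
    intro u hu
    rcases hcases u hu with h | h
    · rwa [hkB u h]
    · rw [hkU' u h]
      exact hU'mem _ (hd.center_mem u h)
  case center_notMem =>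
    intro u hu
    rcases hcases u hu with h | h
    · rw [hkB u h, hMB _ (hz₀B _)]
      simpa using hz₀B s
    · rw [hkU' u h, hMU' _ (hd.center_mem u h)]
      exact hd.center_notMem u h
  case center_eq =>
    intro u hu
    rcases hcases u hu with h | h
    · rw [hkB u h, hkB _ (hz₀B _)]
    · rw [hkU' u h, hkU' _ (hd.center_mem u h)]
      exact hd.center_eq u h
  case center_le =>
    intro u hu
    rcases hcases u hu with h | h
    · rw [hkB u h]
      exact U.min'_le u hu
    · rw [hkU' u h]
      exact hd.center_le u h
  case edist_le =>
    intro u hu huM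
    rcases hcases u hu with h | h
    · rw [hkB u h]
      have huB : u ∈ B s := not_not.mp (mt (hMB u h).mpr huM)
      -- Shortest paths from `z₀` to the core stay in the core, so they survive the deletion of the
      -- marked nodes.
      have key : ∀ i ≤ s, ∀ x ∈ B i,
          (unmarkedGraph G ((U \ (M₀ ∪ M') : Finset ℕ) : Set ℕ)ᶜ).edist z₀ x ≤ (i : ℕ∞) := by
        have hmem : ∀ i ≤ s, ∀ x ∈ B i, x ∉ ((U \ (M₀ ∪ M') : Finset ℕ) : Set ℕ)ᶜ := by
          intro i hi x hx
          have hxs := hBmono hi hx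
          rw [Set.mem_compl_iff, not_not, Finset.mem_coe, Finset.mem_sdiff]
          exact ⟨hBU _ hx, fun hM => (hMB x (hsub01 hxs)).mp hM hxs⟩
        intro i
        induction i with
        | zero =>
          intro _ x hx
          simpa [hB] using (Finset.mem_filter.mp hx).2
        | succ i ihi =>
          intro hi x hx
          by_cases hxi : x ∈ B i
          · exact SimpleGraph.edist_le_mono (ihi (by omega) x hxi) (Nat.le_succ i)
          · obtain ⟨y, hy, hyx⟩ := hBpred i x hx hxi
            exact (SimpleGraph.edist_le_succ_iff _ _ _ _).mpr ⟨y, ihi (by omega) y hy,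
              Or.inr ⟨hyx, hmem i (by omega) y hy, hmem _ hi x hx⟩⟩
      exact SimpleGraph.edist_le_mono (key s le_rfl u huB) (by omega)
    · rw [hkU' u h]
      rw [hMU' u h] at huM
      refine le_trans (SimpleGraph.edist_anti (unmarkedGraph_anti G ?_)) (hd.edist_le u h huM)
      rw [Set.compl_subset_compl, Finset.coe_subset]
      intro x hx
      rw [Finset.mem_sdiff] at hx ⊢
      exact ⟨hU'mem x hx.1, fun hM => hx.2 ((hMU' x hx.1).mp hM)⟩
  case eq_of_adj =>
    intro u hu w hw huM hwM hadj
    rcases hcases u hu with h | h <;> rcases hcases w hw with h' | h'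
    · rw [hkB u h, hkB w h']
    · exact absurd hadj (hBs u (not_not.mp (mt (hMB u h).mpr huM)) w h')
    · exact absurd hadj.symm (hBs w (not_not.mp (mt (hMB w h').mpr hwM)) u h)
    · rw [hkU' u h, hkU' w h']
      exact hd.eq_of_adj u h w h' (mt (hMU' u h).mpr huM) (mt (hMU' w h').mpr hwM) hadj
  case exists_adj =>
    intro u hu
    rcases Finset.mem_union.mp hu with h | h
    · obtain ⟨h1, h2⟩ := Finset.mem_sdiff.mp h
      obtain ⟨w, hw, hadj⟩ := hBpred s u h1 h2
      refine ⟨w, hBU _ hw, fun hM => (hMB w (hsub01 hw)).mp hM hw, hadj.symm, ?_⟩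
      rw [hkB u h1, hkB w (hsub01 hw)]
    · obtain ⟨w, hw, hwM, hadj, hkw⟩ := hd.exists_adj u h
      refine ⟨w, hU'mem w hw, mt (hMU' w hw).mp hwM, hadj, ?_⟩
      rw [hkU' w hw, hkU' u (hd.subset h), hkw]
  case le_of_adj =>
    intro u hu w hw hwM hadj
    rcases Finset.mem_union.mp hu with h | h
    · rw [hkB u (Finset.mem_sdiff.mp h).1]
      rcases hcases w hw with h' | h'
      · rw [hkB w h']
      · exact (hklt w h').le
    · rcases hcases w hw with h' | h'
      · exact absurd hadj.symm (hBs w (not_not.mp (mt (hMB w h').mpr hwM)) u (hd.subset h))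
      · rw [hkU' u (hd.subset h), hkU' w h']
        exact hd.le_of_adj u h w h' (mt (hMU' w h').mpr hwM) hadj
  case card_le =>
    intro z
    by_cases hz : z = z₀
    · have h1 : {u ∈ (U : Set ℕ) | (u ∈ M₀ ∪ M' ∧ k u = z) ∨
          -- Both kinds of charged nodes lie in the two layers around the core `B s`, which `hgrow`
          -- bounds.
          (z < k u ∧ ∃ w ∈ U, G.Adj u w ∧ k w = z)} ⊆ (B (s + 1 + 1) \ B s : Finset ℕ) := by
        rintro u ⟨hu, ⟨huM, hku⟩ | ⟨hku, w, hw, hadj, hkw⟩⟩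
        · have huB := hkz u hu (hku.trans hz)
          exact Finset.mem_sdiff.mpr ⟨hsub12 huB, (hMB u huB).mp huM⟩
        · refine Finset.mem_sdiff.mpr
            ⟨hBadj _ w (hkz w hw (hkw.trans hz)) u hu hadj.symm, fun huB => ?_⟩
          rw [hkB u (hsub01 huB), hz] at hku
          exact lt_irrefl _ hku
      have h2 : ((B s : Finset ℕ) : Set ℕ) ⊆ {u ∈ (U : Set ℕ) | u ∉ M₀ ∪ M' ∧ k u = z} := by
        intro u hu
        exact ⟨hBU _ hu, fun hM => (hMB u (hsub01 hu)).mp hM hu, (hkB u (hsub01 hu)).trans hz.symm⟩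
      have h3 := Set.ncard_le_ncard h1 (Finset.finite_toSet _)
      have h4 := Set.ncard_le_ncard h2 (U.finite_toSet.subset fun u hu => hu.1)
      rw [Set.ncard_coe_finset] at h3 h4
      rw [Finset.card_sdiff_of_subset (hsub01.trans hsub12)] at h3
      refine le_trans (Nat.mul_le_mul_right t h3) (le_trans ?_ h4)
      rw [Nat.sub_mul, mul_comm _ t, mul_comm _ t]
      rw [add_mul, one_mul] at hgrow
      omega
    -- No node of the new cluster is charged to a later center, since `z₀` is smaller than all of
    -- those; the count is the one in `U'`.
    · refine le_trans (Nat.mul_le_mul_right t (Set.ncard_le_ncard ?_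
        (U'.finite_toSet.subset fun u hu => hu.1))) ((hd.card_le z).trans (Set.ncard_le_ncard ?_
        (U.finite_toSet.subset fun u hu => hu.1)))
      · rintro u ⟨hu, h⟩
        rcases hcases u hu with hu' | hu'
        · rw [hkB u hu'] at h
          rcases h with ⟨-, h⟩ | ⟨h, w, hw, -, hkw⟩
          · exact absurd h.symm hz
          · rcases hcases w hw with hw' | hw'
            · exact absurd (hkw.symm.trans (hkB w hw')) hz
            · exact absurd (hklt w hw') (by omega)
        · refine ⟨hu', ?_⟩
          rw [hkU' u hu', hMU' u hu'] at h
          refine h.imp_right fun ⟨h, w, hw, hadj, hkw⟩ => ⟨h, w, ?_⟩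
          have hw' : w ∈ U' :=
            (hcases w hw).resolve_left fun h' => hz (hkw.symm.trans (hkB w h'))
          exact ⟨hw', hadj, hkU' w hw' ▸ hkw⟩
      · rintro u ⟨hu, huM, hku⟩
        exact ⟨hU'mem u hu, mt (hMU' u hu).mp huM, (hkU' u hu).trans hku⟩

/-! ### Recovering a decomposition from its marked nodes -/

theorem core_eq_singleton {G : SimpleGraph ℕ} {M : Set ℕ} {u : ℕ}
    (h : ∀ y, G.Adj u y → u ∈ M) : core G M u = {u} := by
  ext x
  constructor
  · intro hx
    rw [core, Set.mem_ofPred_eq, SimpleGraph.reachable_iff_reflTransGen] at hx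
    rcases Relation.ReflTransGen.cases_head hx with rfl | ⟨y, hy, -⟩
    · rfl
    · exact absurd (h y hy.1) hy.2.1
  · rintro rfl
    exact mem_core_self x

namespace IsDecomposition

variable {G : SimpleGraph ℕ} {t r : ℕ} {V M : Finset ℕ} {k : ℕ → ℕ}

/-- Unmarked edges stay within a cluster, and every unmarked node is joined to its center by
unmarked nodes. -/
theorem core_eq (hd : IsDecomposition G t r V M k) (hG : ∀ u v, G.Adj u v → u ∈ V) {u : ℕ}
    (hu : u ∈ V) (huM : u ∉ M) :
    core G M u = {x ∈ (V : Set ℕ) | x ∉ M ∧ k x = k u} := by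
  have hreach : ∀ x ∈ V, x ∉ M → (unmarkedGraph G M).Reachable (k x) x := by
    intro x hx hxM
    have h := hd.edist_le x hx hxM
    have h1 := SimpleGraph.edist_ne_top_iff_reachable.mp
      (ne_top_of_le_ne_top (ENat.natCast_ne_top _) h)
    refine h1.mono (unmarkedGraph_anti G fun y hy => ?_)
    simp only [Set.mem_compl_iff, Finset.mem_coe, Finset.mem_sdiff]
    exact fun h => h.2 hy
  ext x
  constructor
  · intro hx
    rw [core, Set.mem_ofPred_eq, SimpleGraph.reachable_iff_reflTransGen] at hx
    induction hx with
    | refl => exact ⟨hu, huM, rfl⟩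
    | tail _ hyz ih =>
      obtain ⟨h1, h2, h3⟩ := ih
      obtain ⟨hadj, -, hz⟩ := hyz
      have hzV := hG _ _ hadj.symm
      exact ⟨hzV, hz, (hd.eq_of_adj _ h1 _ hzV h2 hz hadj).symm.trans h3⟩
  · rintro ⟨h1, h2, h3⟩
    exact (hreach u hu huM).symm.trans (h3 ▸ hreach x h1 h2)

theorem isClustering (hd : IsDecomposition G t r V M k) (hG : ∀ u v, G.Adj u v → u ∈ V) :
    IsClustering G M (r + r) := by
  constructor
  · intro u x hx
    by_cases hu : u ∈ V ∧ u ∉ M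
    · rw [hd.core_eq hG hu.1 hu.2] at hx
      have hle : unmarkedGraph G (((V \ M : Finset ℕ) : Set ℕ)ᶜ) ≤ G := fun _ _ h => h.1
      have h1 := (SimpleGraph.edist_anti hle).trans (hd.edist_le u hu.1 hu.2)
      have h2 := (SimpleGraph.edist_anti hle).trans (hd.edist_le x hx.1 hx.2.1)
      rw [hx.2.2] at h2
      rw [SimpleGraph.edist_comm] at h1
      exact SimpleGraph.edist_le_add h1 h2
    · rw [core_eq_singleton fun y hy => by_contra fun h => hu ⟨hG u y hy, h⟩] at hx
      rw [Set.mem_singleton_iff.mp hx]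
      simp
  · intro u hu
    obtain ⟨w, -, hw, hadj, -⟩ := hd.exists_adj u hu
    exact ⟨w, hw, hadj⟩

/-- The center is the smallest identifier of its core, and among the cores adjacent to a marked node
its own comes first. -/
theorem cluster_eq (hd : IsDecomposition G t r V M k) (hG : ∀ u v, G.Adj u v → u ∈ V) {u : ℕ}
    (hu : u ∈ V) : cluster G M u = k u := by
  refine IsLeast.csInf_eq ⟨?_, ?_⟩
  · by_cases huM : u ∈ M
    · obtain ⟨w, hwV, hw, hadj, hk⟩ := hd.exists_adj u huM
      refine ⟨w, hw, Or.inr ⟨huM, hadj⟩, ?_⟩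
      rw [hd.core_eq hG hwV hw, ← hk]
      exact ⟨hd.center_mem w hwV, hd.center_notMem w hwV, hd.center_eq w hwV⟩
    · refine ⟨u, huM, Or.inl rfl, ?_⟩
      rw [hd.core_eq hG hu huM]
      exact ⟨hd.center_mem u hu, hd.center_notMem u hu, hd.center_eq u hu⟩
  · rintro x ⟨w, hw, hwu, hx⟩
    have hwV : w ∈ V := by
      rcases hwu with rfl | ⟨-, hadj⟩
      · exact hu
      · exact hG _ _ hadj.symm
    rw [hd.core_eq hG hwV hw] at hx
    have h1 : k u ≤ k w := by
      rcases hwu with rfl | ⟨huM, hadj⟩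
      · exact le_rfl
      · exact hd.le_of_adj u huM w hwV hw hadj
    exact h1.trans (hx.2.2 ▸ hd.center_le x hx.1)

theorem exists_home_eq (hd : IsDecomposition G t r V M k) (hG : ∀ u v, G.Adj u v → u ∈ V) {u : ℕ}
    (hu : u ∈ V) : ∃ w ∈ V, (w = u ∨ G.Adj u w) ∧ home G M u = k w := by
  obtain ⟨w, hw, hh⟩ := home_spec (G := G) (M := M) u
  have hwV : w ∈ V := by
    rcases hw with rfl | hadj
    · exact hu
    · exact hG _ _ hadj.symm
  exact ⟨w, hwV, hw, hh.trans (hd.cluster_eq hG hwV)⟩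

theorem core_home_eq (hd : IsDecomposition G t r V M k) (hG : ∀ u v, G.Adj u v → u ∈ V) {u : ℕ}
    (hu : u ∈ V) : core G M (home G M u) = {x ∈ (V : Set ℕ) | x ∉ M ∧ k x = home G M u} := by
  obtain ⟨w, hw, -, hh⟩ := hd.exists_home_eq hG hu
  rw [hh, hd.core_eq hG (hd.center_mem w hw) (hd.center_notMem w hw), hd.center_eq w hw]

/-- A crossing node whose own cluster is its home has a neighbour in a later cluster. It must be
marked, because a neighbour of an unmarked node never lies in a later cluster. -/
theorem storedNodes_subset (hd : IsDecomposition G t r V M k) (hG : ∀ u v, G.Adj u v → u ∈ V)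
    (z : ℕ) : storedNodes G M z ⊆ {u ∈ (V : Set ℕ) | (u ∈ M ∧ k u = z) ∨
      (z < k u ∧ ∃ w ∈ V, G.Adj u w ∧ k w = z)} := by
  rintro u ⟨⟨w, hadj, hne⟩, rfl⟩
  have huV := hG _ _ hadj
  have hwV := hG _ _ hadj.symm
  refine ⟨huV, ?_⟩
  have hle := home_le (M := (M : Set ℕ)) (Or.inl rfl : u = u ∨ G.Adj u u)
  have hle' := home_le (M := (M : Set ℕ)) (Or.inr hadj : w = u ∨ G.Adj u w)
  rw [hd.cluster_eq hG huV] at hle hne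
  rw [hd.cluster_eq hG hwV] at hle' hne
  rcases hle.eq_or_lt with heq | hlt
  · refine Or.inl ⟨by_contra fun huM => ?_, heq.symm⟩
    have hlt : k u < k w := lt_of_le_of_ne (heq ▸ hle') hne.symm
    by_cases hwM : w ∈ M
    · exact absurd (hd.le_of_adj w hwM u huV huM hadj.symm) (not_le.mpr hlt)
    · exact hlt.ne (hd.eq_of_adj u huV w hwV huM hwM hadj)
  · obtain ⟨x, hxV, hx, hh⟩ := hd.exists_home_eq hG huV
    refine Or.inr ⟨hlt, x, hxV, hx.resolve_left ?_, hh.symm⟩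
    rintro rfl
    exact hlt.ne hh

theorem hasCapacity (hd : IsDecomposition G t r V M k) (hG : ∀ u v, G.Adj u v → u ∈ V) :
    HasCapacity G M t := by
  rintro u ⟨w, hadj, -⟩
  have hsub := hd.storedNodes_subset hG (home G M u)
  have hfin : {u' ∈ (V : Set ℕ) | (u' ∈ M ∧ k u' = home G M u) ∨
      (home G M u < k u' ∧ ∃ w ∈ V, G.Adj u' w ∧ k w = home G M u)}.Finite :=
    V.finite_toSet.subset fun u hu => hu.1
  rw [hd.core_home_eq hG (hG _ _ hadj)]
  exact ⟨hfin.subset hsub, V.finite_toSet.subset fun u hu => hu.1,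
    (Nat.mul_le_mul_right t (Set.ncard_le_ncard hsub hfin)).trans (hd.card_le _)⟩

end IsDecomposition

/-! ### Encoding -/

theorem List.flatMap_range_take_drop {α : Type*} (l : List α) (q k : ℕ) :
    (List.range k).flatMap (fun i => (l.drop (i * q)).take q) = l.take (k * q) := by
  induction k with
  | zero => simp
  | succ k ih => rw [List.range_succ, List.flatMap_append, ih, Nat.succ_mul, List.take_add]; simp

open Classical in
-- The label of a node is its mark bit followed by the chunk, if any, that is allocated to it.
theorem exists_encoding (G : SimpleGraph ℕ) (V : Finset ℕ) (hG : ∀ u v, G.Adj u v → u ∈ V)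
    {t m q : ℕ} (ht : 1 ≤ t) (hV : V.card < 2 ^ m) (cert : ℕ → BitString)
    (hcert : ∀ u, (cert u).length ≤ t * q) (input : ℕ → BitString) :
    ∃ label : ℕ → BitString, (∀ u, (label u).length ≤ q + 1) ∧ (∀ u, u ∉ V → label u = []) ∧
      IsClustering G (Network.mk G input label).marks (4 * (t * m)) ∧
      HasCapacity G (Network.mk G input label).marks t ∧
      ∀ u, Crossing G (Network.mk G input label).marks u →
        (Network.mk G input label).decode t u = cert u := by
  obtain ⟨M, k, hd⟩ := exists_isDecomposition G ht V hV
  have hcap := hd.hasCapacity hG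
  have hcl := (hd.isClustering hG).mono (D' := 4 * (t * m)) (by omega)
  let slot : ℕ → ℕ → ℕ := fun u i =>
    alloc t (storedNodes G M (home G M u)) (core G M (home G M u)) (u, i)
  let Uses : ℕ → ℕ × ℕ → Prop := fun b x => Crossing G M x.1 ∧ x.2 < t ∧ b = slot x.1 x.2
  have hslot : ∀ u i, Crossing G M u → i < t → slot u i ∈ core G M (home G M u) :=
    fun u i hu hi => by
      obtain ⟨h1, h2, h3⟩ := hcap u hu
      exact (alloc_spec h1 h2 h3).2 (x := (u, i)) ⟨⟨hu, rfl⟩, hi⟩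
  have hV' : ∀ u, Crossing G M u → u ∈ V := fun u ⟨w, hadj, _⟩ => hG _ _ hadj
  -- A place determines its core and hence the home cluster; within one home `alloc` is injective.
  have huniq : ∀ b x y, Uses b x → Uses b y → x = y := by
    rintro b ⟨u, i⟩ ⟨u', i'⟩ ⟨hu, hi, hb⟩ ⟨hu', hi', hb'⟩
    have h1 := hslot u i hu hi
    have h2 := hslot u' i' hu' hi'
    dsimp only at hb hb'
    rw [← hb, hd.core_home_eq hG (hV' u hu)] at h1
    rw [← hb', hd.core_home_eq hG (hV' u' hu')] at h2
    have hh : home G M u = home G M u' := h1.2.2.symm.trans h2.2.2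
    obtain ⟨h3, h4, h5⟩ := hcap u hu
    refine (alloc_spec h3 h4 h5).1 (x₁ := (u, i)) (x₂ := (u', i')) ⟨⟨hu, rfl⟩, hi⟩
      ⟨⟨hu', hh.symm⟩, hi'⟩ ?_
    have := hb.symm.trans hb'
    simp only [slot, ← hh] at this
    exact this
  let pay : ℕ → BitString := fun b =>
    if h : ∃ x, Uses b x then ((cert h.choose.1).drop (h.choose.2 * q)).take q else []
  have hpay : ∀ u i, Crossing G M u → i < t → pay (slot u i) = ((cert u).drop (i * q)).take q := by
    intro u i hu hi
    have hex : ∃ x, Uses (slot u i) x := ⟨(u, i), hu, hi, rfl⟩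
    have heq := huniq _ _ (u, i) hex.choose_spec ⟨hu, hi, rfl⟩
    simp only [pay, dif_pos hex, heq]
  let label : ℕ → BitString := fun u => if u ∈ V then decide (u ∈ M) :: pay u else []
  have hmarks : (Network.mk G input label).marks = M := by
    ext u
    by_cases hu : u ∈ V
    · simp [Network.marks, label, hu]
    · simpa [Network.marks, label, hu] using fun h => hu (hd.subset h)
  refine ⟨label, fun u => ?_, fun u hu => if_neg hu, ?_, ?_, ?_⟩
  · have : (pay u).length ≤ q := by
      simp only [pay]
      split_ifs <;> simp
    by_cases hu : u ∈ V <;> simp [label, hu, this]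
  · rwa [hmarks]
  · rwa [hmarks]
  · intro u hu
    unfold Network.decode
    rw [hmarks] at hu ⊢
    rw [← List.take_of_length_le (hcert u), ← List.flatMap_range_take_drop]
    refine List.flatMap_congr fun i hi => ?_
    have hi' := List.mem_range.mp hi
    rw [← hpay u i hu hi']
    have hmem := hslot u i hu hi'
    rw [hd.core_home_eq hG (hV' u hu)] at hmem
    change (label (slot u i)).tail = _
    simp [label, show slot u i ∈ V from hmem.1]

/-! ### Views -/

theorem SimpleGraph.edist_map_le_iff {V W : Type*} (G : SimpleGraph V) (f : V ↪ W) (k : ℕ)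
    (u : V) (x : W) :
    (G.map f).edist (f u) x ≤ (k : ℕ∞) ↔ ∃ y, f y = x ∧ G.edist u y ≤ (k : ℕ∞) := by
  induction k generalizing x with
  | zero =>
    simp only [Nat.cast_zero, nonpos_iff_eq_zero, SimpleGraph.edist_eq_zero_iff]
    exact ⟨fun h => ⟨u, h, rfl⟩, by rintro ⟨_, h, rfl⟩; exact h⟩
  | succ k ih =>
    rw [SimpleGraph.edist_le_succ_iff]
    constructor
    · rintro ⟨w, hw, hwx⟩
      obtain ⟨y, rfl, hy⟩ := (ih w).mp hw
      rcases hwx with rfl | hadj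
      · exact ⟨y, rfl, SimpleGraph.edist_le_mono hy (Nat.le_succ k)⟩
      · obtain ⟨-, a, b, hab, ha, rfl⟩ := hadj
        rw [f.injective ha] at hab
        exact ⟨b, rfl, (SimpleGraph.edist_le_succ_iff _ _ _ _).mpr ⟨y, hy, Or.inr hab⟩⟩
    · rintro ⟨y, rfl, hy⟩
      obtain ⟨w, hw, hwy⟩ := (SimpleGraph.edist_le_succ_iff _ _ _ _).mp hy
      refine ⟨f w, (ih _).mpr ⟨w, rfl, hw⟩, hwy.imp (congrArg f) fun h => ?_⟩
      exact (SimpleGraph.map_adj_apply).mpr h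

open Classical in
/-- The view of the node `v` in a network, with the number of nodes set to `n`. -/
noncomputable def Network.view (N : Network) (n r v : ℕ) : View where
  size := n
  center := v
  nodes := {x | N.graph.edist v x ≤ (r : ℕ∞)}
  adj a b := N.graph.edist v a ≤ (r : ℕ∞) ∧ N.graph.edist v b ≤ (r : ℕ∞) ∧ N.graph.Adj a b
  input a := if N.graph.edist v a ≤ (r : ℕ∞) then some (N.input a) else none
  label a := if N.graph.edist v a ≤ (r : ℕ∞) then some (N.label a) else none

theorem Network.Agree.view_eq {N N' : Network} {v r : ℕ} (h : N.Agree N' v r) (n : ℕ) :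
    N.view n r v = N'.view n r v := by
  have hiff : ∀ x, N.graph.edist v x ≤ (r : ℕ∞) ↔ N'.graph.edist v x ≤ (r : ℕ∞) := fun x =>
    ⟨h.edist_le (Nat.le_succ r), h.edist_le' (Nat.le_succ r)⟩
  unfold Network.view
  simp only [← hiff]
  congr 1
  · ext a b
    exact and_congr_right fun ha => by rw [(h a ha).1]
  · ext1 a
    split_ifs with ha
    · rw [(h a ha).2.1]
    · rfl
  · ext1 a
    split_ifs with ha
    · rw [(h a ha).2.2]
    · rfl

theorem Network.input_label_eq_of_view_eq {N N' : Network} {n n' v r : ℕ}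
    (h : N.view n r v = N'.view n' r v) {x : ℕ} (hx : N.graph.edist v x ≤ (r : ℕ∞)) :
    N.input x = N'.input x ∧ N.label x = N'.label x := by
  have hx' : N'.graph.edist v x ≤ (r : ℕ∞) :=
    (Set.ext_iff.mp (congrArg View.nodes h) x).mp hx
  have h1 := congrFun (congrArg View.input h) x
  have h2 := congrFun (congrArg View.label h) x
  simp only [Network.view, if_pos hx, if_pos hx', Option.some.injEq] at h1 h2
  exact ⟨h1, h2⟩

/-- One hop is lost because a view shows only induced edges: those leaving the ball of radius `r`
become visible at radius `r + 1`. -/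
theorem Network.agree_of_view_eq {N N' : Network} {n n' v r : ℕ}
    (h : N.view n (r + 1) v = N'.view n' (r + 1) v) : N.Agree N' v r := by
  have hnodes : ∀ x, N.graph.edist v x ≤ ((r + 1 : ℕ) : ℕ∞) ↔
      N'.graph.edist v x ≤ ((r + 1 : ℕ) : ℕ∞) :=
    fun x => Set.ext_iff.mp (congrArg View.nodes h) x
  have hadj : ∀ a b, (N.graph.edist v a ≤ ((r + 1 : ℕ) : ℕ∞) ∧
      N.graph.edist v b ≤ ((r + 1 : ℕ) : ℕ∞) ∧ N.graph.Adj a b) ↔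
      (N'.graph.edist v a ≤ ((r + 1 : ℕ) : ℕ∞) ∧
      N'.graph.edist v b ≤ ((r + 1 : ℕ) : ℕ∞) ∧ N'.graph.Adj a b) :=
    fun a b => iff_of_eq (congrFun (congrFun (congrArg View.adj h) a) b)
  have hsub : ∀ k ≤ r, ∀ x, N.graph.edist v x ≤ (k : ℕ∞) → N'.graph.edist v x ≤ (k : ℕ∞) := by
    intro k
    induction k with
    | zero => exact fun _ x hx => by simpa using hx
    | succ k ih =>
      intro hk x hx
      have hx1 := SimpleGraph.edist_le_mono hx (by omega : k + 1 ≤ r + 1)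
      rw [SimpleGraph.edist_le_succ_iff] at hx ⊢
      obtain ⟨w, hw, hwx⟩ := hx
      refine ⟨w, ih (by omega) w hw, hwx.imp_right fun hwx => ?_⟩
      exact ((hadj w x).mp ⟨SimpleGraph.edist_le_mono hw (by omega), hx1, hwx⟩).2.2
  intro x hx
  have hx1 := SimpleGraph.edist_le_mono hx (Nat.le_succ r)
  refine ⟨fun y => ⟨fun hxy => ?_, fun hxy => ?_⟩, Network.input_label_eq_of_view_eq h hx1⟩
  · exact ((hadj x y).mp ⟨hx1, SimpleGraph.edist_le_add hx hxy.edist_le_one, hxy⟩).2.2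
  · exact ((hadj x y).mpr ⟨(hnodes x).mp hx1,
      SimpleGraph.edist_le_add (hsub r le_rfl x hx) hxy.edist_le_one, hxy⟩).2.2

namespace Config

/-- The graph of a configuration, with all other natural numbers as isolated nodes. -/
def natGraph (C : Config) : SimpleGraph ℕ := C.net.graph.map (Function.Embedding.subtype _)

/-- A function on the nodes, extended by the empty string. -/
def extend (C : Config) (l : C.Node → BitString) (a : ℕ) : BitString :=
  if h : a ∈ C.net.verts then l ⟨a, h⟩ else []

/-- A labelled configuration as a network on the natural numbers. -/
def toNetwork (C : Config) (l : C.Node → BitString) : Network where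
  graph := C.natGraph
  input := C.extend C.input
  label := C.extend l

variable (C : Config)

theorem extend_coe (l : C.Node → BitString) (v : C.Node) : C.extend l v = l v := by
  simp [extend, v.2]

theorem mem_verts_of_adj {u v : ℕ} (h : C.natGraph.Adj u v) : u ∈ C.net.verts := by
  obtain ⟨-, a, b, -, rfl, -⟩ := h
  exact a.2

theorem mem_verts_of_edist_le {v : C.Node} {x k : ℕ} (h : C.natGraph.edist v x ≤ (k : ℕ∞)) :
    x ∈ C.net.verts := by
  obtain ⟨y, rfl, -⟩ := (SimpleGraph.edist_map_le_iff _ (Function.Embedding.subtype _) k v x).mp h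
  exact y.2

/-- Moving to networks on ℕ allows configurations with different node types to be compared directly.
-/
theorem view_eq_toNetwork_view (l : C.Node → BitString) (r : ℕ) (v : C.Node) :
    C.view l r v = (C.toNetwork l).view C.net.size r v := by
  have hball : ∀ a : ℕ, (∃ x ∈ C.ball r v, (x : ℕ) = a) ↔
      (C.toNetwork l).graph.edist v a ≤ (r : ℕ∞) := by
    intro a
    refine Iff.trans ?_
      (SimpleGraph.edist_map_le_iff C.net.graph (Function.Embedding.subtype _) r v a).symm
    exact exists_congr fun x => and_comm
  unfold Config.view Network.view
  congr 1
  · ext a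
    exact hball a
  · ext a b
    constructor
    · rintro ⟨x, hx, y, hy, rfl, rfl, hxy⟩
      exact ⟨(hball _).mp ⟨x, hx, rfl⟩, (hball _).mp ⟨y, hy, rfl⟩,
        SimpleGraph.map_adj_apply (f := Function.Embedding.subtype _).mpr hxy⟩
    · rintro ⟨ha, hb, -, x, y, hxy, rfl, rfl⟩
      obtain ⟨x', hx', hxx⟩ := (hball _).mpr ha
      obtain ⟨y', hy', hyy⟩ := (hball _).mpr hb
      obtain rfl : x' = x := Subtype.ext hxx
      obtain rfl : y' = y := Subtype.ext hyy
      exact ⟨x', hx', y', hy', rfl, rfl, hxy⟩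
  · ext1 a
    by_cases h : ∃ x ∈ C.ball r v, (x : ℕ) = a
    · rw [dif_pos h, if_pos ((hball a).mp h)]
      conv_rhs => rw [← h.choose_spec.2]
      exact congrArg some (C.extend_coe _ _).symm
    · rw [dif_neg h, if_neg (mt (hball a).mpr h)]
  · ext1 a
    by_cases h : ∃ x ∈ C.ball r v, (x : ℕ) = a
    · rw [dif_pos h, if_pos ((hball a).mp h)]
      conv_rhs => rw [← h.choose_spec.2]
      exact congrArg some (C.extend_coe _ _).symm
    · rw [dif_neg h, if_neg (mt (hball a).mpr h)]

theorem not_adj_of_size_lt_two (h : C.net.size < 2) (u v : ℕ) : ¬ C.natGraph.Adj u v := by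
  intro hadj
  have h1 := C.mem_verts_of_adj hadj
  have h2 := C.mem_verts_of_adj hadj.symm
  have := Finset.card_le_one.mp (Nat.lt_succ_iff.mp h) u h1 v h2
  exact hadj.ne this

end Config

/-! ### Trading radius for label size -/

namespace PLS

variable {𝒢 : Set NetGraph} {ℐ : Set BitString} {P : configs 𝒢 ℐ → Prop}

theorem length_prov_le {r : ℕ → ℕ} (S : PLS P r) {n p : ℕ} (h : S.cost n ≤ p) (C : configs 𝒢 ℐ)
    (hC : P C) (hn : C.1.net.size = n) (v : C.1.Node) : (S.prov C v).length ≤ p := by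
  have : ((S.prov C v).length : ℕ∞) ≤ S.cost n :=
    le_iSup_of_le C (le_iSup_of_le ⟨hC, hn⟩ (le_iSup_of_le v le_rfl))
  exact_mod_cast this.trans h

/-- The certificates of the honest prover, on all natural numbers. -/
def cert {r : ℕ → ℕ} (S : PLS P r) (C : configs 𝒢 ℐ) : ℕ → BitString := C.1.extend (S.prov C)

theorem length_cert_le {r : ℕ → ℕ} (S : PLS P r) {p : ℕ} (C : configs 𝒢 ℐ)
    (h : S.cost C.1.net.size ≤ p) (hC : P C) (u : ℕ) : (S.cert C u).length ≤ p := by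
  unfold cert Config.extend
  split_ifs
  · exact S.length_prov_le h C hC rfl _
  · simp

/-- A configuration satisfies `P` if around each of its nodes it looks like a certified one. -/
theorem of_forall_agree {r : ℕ → ℕ} (S : PLS P r) (C : configs 𝒢 ℐ) (l : C.1.Node → BitString)
    (h : ∀ v : C.1.Node, ∃ C' : configs 𝒢 ℐ, P C' ∧ C'.1.net.size = C.1.net.size ∧
      (v : ℕ) ∈ C'.1.net.verts ∧
      (C.1.toNetwork l).Agree (C'.1.toNetwork (S.prov C')) v (r C.1.net.size)) : P C := by
  refine S.soundness C l fun v => ?_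
  obtain ⟨C', hP, hsize, hv, hagree⟩ := h v
  have := S.completeness C' hP ⟨v, hv⟩
  rw [Config.view_eq_toNetwork_view, hsize] at this
  rwa [Config.view_eq_toNetwork_view, hagree.view_eq]

/-- The label `l` is a distributed encoding of the certificates of `S` for `C`. -/
structure Encodes {r : ℕ → ℕ} (S : PLS P r) (C : configs 𝒢 ℐ) (l : C.1.Node → BitString)
    (D t : ℕ) : Prop where
  isClustering : IsClustering C.1.natGraph (C.1.toNetwork l).marks D
  hasCapacity : HasCapacity C.1.natGraph (C.1.toNetwork l).marks t
  decode_eq : ∀ u, Crossing C.1.natGraph (C.1.toNetwork l).marks u →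
    (C.1.toNetwork l).decode t u = S.cert C u

theorem exists_encodes {r : ℕ → ℕ} (S : PLS P r) (C : configs 𝒢 ℐ) (hC : P C) {p t : ℕ}
    (hp : S.cost C.1.net.size ≤ p) (ht : 1 ≤ t) (hn : 2 ≤ C.1.net.size) :
    ∃ l : C.1.Node → BitString, (∀ v, (l v).length ≤ ⌈(p : ℚ) / (t : ℚ)⌉₊ + 1) ∧
      S.Encodes C l (8 * (t * Nat.log 2 C.1.net.size)) t := by
  have hq : p ≤ t * ⌈(p : ℚ) / (t : ℚ)⌉₊ := by
    have h := Nat.le_ceil ((p : ℚ) / (t : ℚ))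
    rw [div_le_iff₀ (by positivity)] at h
    rw [mul_comm]
    exact_mod_cast h
  obtain ⟨label, hlen, hout, hcl, hcap, hdec⟩ := exists_encoding C.1.natGraph C.1.net.verts
    (fun u v h => C.1.mem_verts_of_adj h) ht (Nat.lt_pow_succ_log_self one_lt_two C.1.net.size)
    (S.cert C) (fun u => (S.length_cert_le C hp hC u).trans hq) (C.1.extend C.1.input)
  have hnet : C.1.toNetwork (fun v => label v) = ⟨C.1.natGraph, C.1.extend C.1.input, label⟩ := by
    unfold Config.toNetwork
    congr 1
    ext1 a
    unfold Config.extend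
    split_ifs with h
    · rfl
    · exact (hout a h).symm
  have hlog : 1 ≤ Nat.log 2 C.1.net.size := Nat.log_pos one_lt_two hn
  refine ⟨fun v => label v, fun v => hlen v, ?_, ?_, ?_⟩
  · rw [hnet]
    -- The exponent is ⌊log₂ n⌋ + 1, at most 2⌊log₂ n⌋ for n ≥ 2; this turns 4 into 8.
    refine hcl.mono ?_
    have := Nat.mul_le_mul_left t hlog
    rw [Nat.mul_succ]
    omega
  · rwa [hnet]
  · rwa [hnet]

/-- Soundness if there is nothing to encode. -/
theorem of_forall_view_eq (S : PLS P fun _ => 1) (C : configs 𝒢 ℐ) (l : C.1.Node → BitString)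
    (l' : (C' : configs 𝒢 ℐ) → C'.1.Node → BitString) (R : ℕ)
    (hR : 2 ≤ C.1.net.size → 2 ≤ R)
    (hcert : 2 ≤ C.1.net.size → ∀ C' : configs 𝒢 ℐ, P C' → C'.1.net.size = C.1.net.size →
      ∀ u, S.cert C' u = [])
    (h : ∀ v : C.1.Node, ∃ C' : configs 𝒢 ℐ, P C' ∧ C'.1.net.size = C.1.net.size ∧
      (v : ℕ) ∈ C'.1.net.verts ∧ (C.1.toNetwork l).view C.1.net.size R v =
        (C'.1.toNetwork (l' C')).view C.1.net.size R v) : P C := by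
  choose C' hP hsize hv hview using h
  refine S.of_forall_agree C (fun u => S.cert (C' u) u) fun v =>
    ⟨C' v, hP v, hsize v, hv v, ?_⟩
  by_cases hn : 2 ≤ C.1.net.size
  · obtain ⟨R', rfl⟩ := Nat.exists_eq_add_of_le' (hR hn)
    have hag := (Network.agree_of_view_eq (r := R' + 1) (hview v)).mono (R' := 1) (by omega)
    refine fun x hx => ⟨(hag x hx).1, (hag x hx).2.1, ?_⟩
    refine Eq.trans ?_ (hcert hn (C' v) (hP v) (hsize v) x).symm
    simp only [Config.toNetwork, Config.extend]
    split_ifs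
    · exact hcert hn _ (hP _) (hsize _) _
    · rfl
  -- Here `R` may be 0, but without edges the 1-hop neighbourhood is the node itself.
  · have hno := C.1.not_adj_of_size_lt_two (by omega)
    have hno' := (C' v).1.not_adj_of_size_lt_two (by have := hsize v; omega)
    intro x hx
    obtain ⟨w, hw, hwx⟩ := (SimpleGraph.edist_le_succ_iff _ 0 _ _).mp hx
    obtain rfl : (v : ℕ) = w := by simpa using hw
    obtain rfl : (v : ℕ) = x := hwx.resolve_right (hno _ _)
    refine ⟨fun y => iff_of_false (hno _ y) (hno' _ y),
      (Network.input_label_eq_of_view_eq (hview v) (by simp)).1, ?_⟩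
    exact C.1.extend_coe (fun u => S.cert (C' u) u) v

/-- Soundness if the certificates are encoded in the labels. -/
theorem of_forall_view_eq_encodes (S : PLS P fun _ => 1) (C : configs 𝒢 ℐ)
    (l : C.1.Node → BitString) (l' : (C' : configs 𝒢 ℐ) → C'.1.Node → BitString) {R D t : ℕ}
    (hR : 4 * D + 12 ≤ R)
    (h : ∀ v : C.1.Node, ∃ C' : configs 𝒢 ℐ, P C' ∧ C'.1.net.size = C.1.net.size ∧
      (v : ℕ) ∈ C'.1.net.verts ∧ S.Encodes C' (l' C') D t ∧
      (C.1.toNetwork l).view C.1.net.size R v =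
        (C'.1.toNetwork (l' C')).view C.1.net.size R v) : P C := by
  choose C' hP hsize hv henc hview using h
  set N := C.1.toNetwork l
  set N' : C.1.Node → Network := fun v => (C' v).1.toNetwork (l' (C' v))
  -- `D + 1` hops are spent on reaching the node that names the cluster; the other `3 * D + 10`
  -- cover one further hop and the `3 * D + 7` of `Agree.decode_eq`.
  have hag : ∀ v : C.1.Node, N.Agree (N' v) v (4 * D + 11) := fun v => by
    obtain ⟨R', rfl⟩ := Nat.exists_eq_add_of_le' (by omega : 1 ≤ R)
    exact (Network.agree_of_view_eq (hview v)).mono (by omega)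
  have hcl' : ∀ v, IsClustering (N' v).graph (N' v).marks D := fun v => (henc v).isClustering
  -- The labels `l` are arbitrary, so the bounds on cores are imported from the witnesses through
  -- the one-sided `Agree.core_eq`.
  have hcl : IsClustering N.graph N.marks D := by
    constructor
    · intro u x hx
      by_cases hu : u ∈ C.1.net.verts
      · have hag' := hag ⟨u, hu⟩
        rw [(hag'.mono (by omega)).core_eq (D := D) ((hcl' _).bounded u)] at hx
        exact hag'.edist_le' (by omega) ((hcl' _).bounded u x hx)
      · rw [core_eq_singleton (G := N.graph) fun y hy => absurd (C.1.mem_verts_of_adj hy) hu] at hx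
        rw [Set.mem_singleton_iff.mp hx]
        simp
    · intro u hu
      have huV : u ∈ C.1.net.verts := by
        by_contra hcon
        have : N.label u = [] := dif_neg hcon
        simp [Network.marks, this] at hu
      have hag' := hag ⟨u, huV⟩
      obtain ⟨w, hw, hadj⟩ := (hcl' ⟨u, huV⟩).covered u (hag'.mem_marks_iff.mp hu)
      have hadj' := (hag'.adj_iff w).mpr hadj
      exact ⟨w, fun h => hw ((hag'.step (R := 4 * D + 10) (Or.inr hadj')).mem_marks_iff.mp h),
        hadj'⟩
  have hmem : ∀ u : C.1.Node, cluster N.graph N.marks u ∈ C.1.net.verts := fun u =>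
    C.1.mem_verts_of_edist_le (hcl.edist_cluster u)
  -- All nodes of a cluster use the witness of the same node.
  let z : C.1.Node → C.1.Node := fun u => ⟨cluster N.graph N.marks u, hmem u⟩
  have hagz : ∀ u : C.1.Node, N.Agree (N' (z u)) u (3 * D + 10) := fun u => by
    have h1 := hcl.edist_cluster u
    rw [SimpleGraph.edist_comm] at h1
    exact (hag (z u)).recenter h1 (by omega)
  have hdec : ∀ (u : C.1.Node) (x : ℕ), N.Agree (N' u) x (3 * D + 7) →
      Crossing N.graph N.marks x → N.decode t x = S.cert (C' u) x := by
    intro u x hx hcr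
    have hcr' := ((hx.mono (by omega)).crossing_iff (hcl' u)).mp hcr
    rw [hx.decode_eq hcl (hcl' u) (henc u).hasCapacity hcr']
    exact (henc u).decode_eq x hcr'
  refine S.of_forall_agree C (fun u => S.cert (C' (z u)) u) fun v =>
    ⟨C' (z v), hP _, hsize _, ?_, fun x hx => ?_⟩
  · have h1 := hcl.edist_cluster v
    rw [SimpleGraph.edist_comm] at h1
    exact (C' (z v)).1.mem_verts_of_edist_le (v := ⟨z v, hv (z v)⟩)
      ((hag (z v)).edist_le (by omega) h1)
  · have hx1 := ((hagz v).mono (R' := 1) (by omega)) x hx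
    refine ⟨hx1.1, hx1.2.1, ?_⟩
    have hxV : x ∈ C.1.net.verts := C.1.mem_verts_of_edist_le hx
    refine (C.1.extend_coe (fun u => S.cert (C' (z u)) u) ⟨x, hxV⟩).trans ?_
    change S.cert (C' (z ⟨x, hxV⟩)) x = S.cert (C' (z v)) x
    -- If the clusters differ, `x` is crossing, and both witnesses' certificates for `x` equal the
    -- string decoded in `N`.
    by_cases hz : z ⟨x, hxV⟩ = z v
    · rw [hz]
    · have hne : cluster N.graph N.marks x ≠ cluster N.graph N.marks v := fun h =>
        hz (Subtype.ext h)
      have hadj : N.graph.Adj v x := by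
        obtain ⟨w, hw, hwx⟩ := (SimpleGraph.edist_le_succ_iff _ 0 _ _).mp hx
        obtain rfl : (v : ℕ) = w := by simpa using hw
        exact hwx.resolve_left fun h => hne (h ▸ rfl)
      have hcr : Crossing N.graph N.marks x := ⟨v, hadj.symm, hne.symm⟩
      rw [← hdec _ x ((hagz ⟨x, hxV⟩).mono (by omega)) hcr,
        ← hdec _ x ((hagz v).recenter hx (by omega)) hcr]

end PLS

theorem theorem1 (c : ℕ) :
    ∃ K : ℕ, ∀ (𝒢 : Set NetGraph) (ℐ : Set BitString),
      (∀ G ∈ 𝒢, G.graph.Connected) → (∀ G ∈ 𝒢, G.IdBitsLE c) →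
      ∀ (P : configs 𝒢 ℐ → Prop) (p : ℕ → ℕ),
        (∃ S₁ : PLS P (fun _ => 1), ∀ n, S₁.cost n ≤ p n) →
        ∀ t : ℕ → ℕ, (∀ n, 1 ≤ t n) →
          ∃ S : PLS P (fun n => K * t n * Nat.log 2 n),
            ∀ n, S.cost n ≤ ((K * ⌈(p n : ℚ) / (t n : ℚ)⌉₊ : ℕ) : ℕ∞) := by
  -- With X = t⌊log₂ n⌋ ≥ 1 and D = 8X, the required radius 4D + 12 is at most 44X.
  refine ⟨44, fun 𝒢 ℐ _ _ P p ⟨S₁, hS₁⟩ t ht => ?_⟩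
  have hprov : ∀ C : configs 𝒢 ℐ, ∃ l : C.1.Node → BitString, P C →
      (∀ v, (l v).length ≤ 44 * ⌈(p C.1.net.size : ℚ) / (t C.1.net.size : ℚ)⌉₊) ∧
      (p C.1.net.size ≠ 0 → 2 ≤ C.1.net.size →
        S₁.Encodes C l (8 * (t C.1.net.size * Nat.log 2 C.1.net.size)) (t C.1.net.size)) := by
    intro C
    by_cases hC : P C ∧ p C.1.net.size ≠ 0 ∧ 2 ≤ C.1.net.size
    · obtain ⟨hP, hp, hn⟩ := hC
      obtain ⟨l, hlen, henc⟩ := S₁.exists_encodes C hP (hS₁ _) (ht _) hn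
      refine ⟨l, fun _ => ⟨fun v => (hlen v).trans ?_, fun _ _ => henc⟩⟩
      -- Since p ≠ 0 the ceiling is positive and absorbs the mark bit; for p = 0 the labels have to
      -- be empty.
      have : 0 < ⌈(p C.1.net.size : ℚ) / (t C.1.net.size : ℚ)⌉₊ := by
        have := ht C.1.net.size
        exact Nat.ceil_pos.mpr (by positivity)
      omega
    · exact ⟨fun _ => [], fun hP => ⟨fun v => by simp, fun h1 h2 => absurd ⟨hP, h1, h2⟩ hC⟩⟩
  choose prov hprov using hprov
  let S : PLS P (fun n => 44 * t n * Nat.log 2 n) :=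
    { prov := prov
      ver := fun w => ∃ C' : configs 𝒢 ℐ, P C' ∧ ∃ v' : C'.1.Node,
        w = C'.1.view (prov C') (44 * t C'.1.net.size * Nat.log 2 C'.1.net.size) v'
      completeness := fun C hC v => ⟨C, hC, v, rfl⟩
      soundness := ?_ }
  · refine ⟨S, fun n => iSup_le fun C => iSup_le fun hC => iSup_le fun v => ?_⟩
    have h := (hprov C hC.1).1 v
    rw [hC.2] at h
    exact_mod_cast h
  · intro C l hacc
    set n := C.1.net.size with hn
    have hX : 2 ≤ n → 1 ≤ t n * Nat.log 2 n := fun h =>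
      Nat.mul_pos (ht n) (Nat.log_pos one_lt_two h)
    have hview : ∀ v : C.1.Node, ∃ C' : configs 𝒢 ℐ, P C' ∧ C'.1.net.size = n ∧
        (v : ℕ) ∈ C'.1.net.verts ∧ (C.1.toNetwork l).view n (44 * (t n * Nat.log 2 n)) v =
          (C'.1.toNetwork (prov C')).view n (44 * (t n * Nat.log 2 n)) v := by
      intro v
      obtain ⟨C', hP, v', h⟩ := hacc v
      have hsize : n = C'.1.net.size := congrArg View.size h
      have hcenter : (v : ℕ) = v' := congrArg View.center h
      refine ⟨C', hP, hsize.symm, hcenter ▸ v'.2, ?_⟩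
      rw [Config.view_eq_toNetwork_view, Config.view_eq_toNetwork_view, ← hsize, ← hcenter,
        mul_assoc] at h
      exact h
    by_cases htriv : p n ≠ 0 ∧ 2 ≤ n
    · refine S₁.of_forall_view_eq_encodes C l prov (D := 8 * (t n * Nat.log 2 n)) (t := t n)
        (R := 44 * (t n * Nat.log 2 n)) (by have := hX htriv.2; omega) fun v => ?_
      obtain ⟨C', hP, hsize, hv, h⟩ := hview v
      refine ⟨C', hP, hsize, hv, ?_, h⟩
      have := (hprov C' hP).2
      rw [hsize] at this
      exact this htriv.1 htriv.2
    · refine S₁.of_forall_view_eq C l prov (44 * (t n * Nat.log 2 n))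
        (fun h => by have := hX h; omega) (fun h C' hP hsize u => ?_) hview
      have hp : p n = 0 := by
        by_contra hp
        exact htriv ⟨hp, h⟩
      have := S₁.length_cert_le C' (hS₁ _) hP u
      rw [hsize, ← hn, hp] at this
      exact List.length_eq_zero_iff.mp (Nat.le_zero.mp this)
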